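/- Let $\overline{\mathbb N}=\mathbb N\cup\{\infty\}$. A *binary numerical function* is a map $f\colon\overline{\mathbb N}^2\to\overline{\mathbb N}$ that is non-decreasing in each argument and satisfies $f(a,b)=\infty$ if and only if $a=\infty$ or $b=\infty$. For an element $a$ of a local ring $(A,\mathfrak m)$, let $\operatorname{ord}_A(a)\in\overline{\mathbb N}$ be its $\mathfrak m$-adic order, i.e. the supremum of all $n$ with $a\in\mathfrak m^n$ (in $\operatorname{ord}_{R/I}(y)$ the image of $y$ in $R/I$ is meant), and let $\ell$ denote length. The multiplicity of a $d$-dimensional Noetherian local ring $R$ is the number $e$ such that the polynomial giving $\ell(R/\mathfrak m^n)$ for all large $n$ has leading coefficient $e/d!$. For a binary numerical function $f$ and a Noetherian local ring $R$ of dimension $d\ge 1$, consider the condition $$ \operatorname{ord}_R(x_1y_1+\dots+x_dy_d)\le f\bigl(\ell(R/(x_1,\dots,x_d)R),\ \operatorname{ord}_{R/(x_1,\dots,x_{d-1})R}(y_d)\bigr)\qquad(\ast) $$ for all $d$-tuples $(x_1,\dots,x_d)$ and $(y_1,\dots,y_d)$ of elements of $R$ such that $(x_1,\dots,x_d)$ is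 a system of parameters of $R$. **Theorem.** A Noetherian local ring $R$ of dimension $d\ge1$ is Cohen–Macaulay if and only if there exists a binary numerical function $\delta_R$ such that $(\ast)$ holds with $f=\delta_R$. Moreover, $\delta_R$ can be chosen to depend only on the dimension and the multiplicity of $R$: there is a family $(\delta_{d,e})_{d,e\in\mathbb N}$ of binary numerical functions such that every Noetherian local ring $R$ of dimension $d\geq 1$ and multiplicity $e$ is Cohen–Macaulay if and only if $(\ast)$ holds for $R$ with $f=\delta_{d,e}$. -/

import Mathlib

universe u

namespace UniformCM

open IsLocalRing Filter

/-- The `J`-adic order of an element `a` of a commutative ring: the largest `n` with `a ∈ J ^ n`,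
and `∞` if `a` lies in every power of `J`. -/
noncomputable def adicOrder {A : Type*} [CommRing A] (J : Ideal A) (a : A) : ℕ∞ :=
  ⨆ (n : ℕ) (_ : a ∈ J ^ n), (n : ℕ∞)

/-- The order `ord_R a` of an element `a` of a local ring `R`, with respect to the powers of its
maximal ideal. -/
noncomputable def ord {R : Type*} [CommRing R] [IsLocalRing R] (a : R) : ℕ∞ :=
  adicOrder (maximalIdeal R) a

/-- The order `ord_{R/I} a` of the image of `a` in the residue ring `R ⧸ I` of a local ring `R`,
with respect to the powers of the (image of the) maximal ideal in `R ⧸ I`. -/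
noncomputable def ordMod {R : Type*} [CommRing R] [IsLocalRing R] (I : Ideal R) (a : R) : ℕ∞ :=
  adicOrder ((maximalIdeal R).map (Ideal.Quotient.mk I)) (Ideal.Quotient.mk I a)

/-- A tuple `x` of length `d = dim R` that generates an ideal primary to the maximal ideal. -/
def IsSystemOfParameters {R : Type*} [CommRing R] [IsLocalRing R] {d : ℕ} (x : Fin d → R) : Prop :=
  ringKrullDim R = (d : WithBot ℕ∞) ∧ (Ideal.span (Set.range x)).radical = maximalIdeal R

/-- The depth of a (Noetherian) local ring: the supremum of the lengths of the `R`-regular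
sequences contained in its maximal ideal. -/
noncomputable def depth (R : Type*) [CommRing R] [IsLocalRing R] : ℕ∞ :=
  ⨆ (rs : List R) (_ : (∀ r ∈ rs, r ∈ maximalIdeal R) ∧ RingTheory.Sequence.IsRegular R rs),
    (rs.length : ℕ∞)

/-- A Noetherian local ring is Cohen-Macaulay if its depth equals its Krull dimension. -/
def IsCohenMacaulay (R : Type*) [CommRing R] [IsLocalRing R] : Prop :=
  ringKrullDim R = (depth R : WithBot ℕ∞)

/-- `P` is the Hilbert-Samuel polynomial of `R`: it has rational coefficients and `P(n)` is the
length of `R ⧸ 𝔪 ^ n` for all large `n`. -/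
def IsHilbertSamuelPolynomial (R : Type*) [CommRing R] [IsLocalRing R] (P : Polynomial ℚ) : Prop :=
  ∀ᶠ n : ℕ in atTop, ∃ l : ℕ, Module.length R (R ⧸ maximalIdeal R ^ n) = (l : ℕ∞) ∧
    P.eval (n : ℚ) = (l : ℚ)

/-- The leading coefficient of the Hilbert-Samuel polynomial of `R` is `e / d!`, where
`d = dim R`. -/
def HasMultiplicity (R : Type*) [CommRing R] [IsLocalRing R] (e : ℕ) : Prop :=
  ∃ (d : ℕ) (P : Polynomial ℚ), ringKrullDim R = (d : WithBot ℕ∞) ∧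
    IsHilbertSamuelPolynomial R P ∧ P.leadingCoeff = (e : ℚ) / (d.factorial : ℚ)

/-- At most one number is a multiplicity of `R`. -/
theorem HasMultiplicity.unique {R : Type*} [CommRing R] [IsLocalRing R] {e e' : ℕ}
    (h : HasMultiplicity R e) (h' : HasMultiplicity R e') : e = e' := by
  obtain ⟨d, P, hd, hP, he⟩ := h
  obtain ⟨d', P', hd', hP', he'⟩ := h'
  have hdd : d = d' := by
    have := hd.symm.trans hd'
    exact_mod_cast this
  subst hdd
  have hPP : P = P' := by
    obtain ⟨N, hN⟩ := eventually_atTop.1 (hP.and hP')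
    refine Polynomial.eq_of_infinite_eval_eq P P' ?_
    refine Set.Infinite.mono (s := (fun n : ℕ => (n : ℚ)) '' Set.Ici N) ?_ ?_
    · rintro _ ⟨n, hn, rfl⟩
      obtain ⟨⟨l, hl, hPl⟩, ⟨l', hl', hPl'⟩⟩ := hN n hn
      have : l = l' := by
        have := hl.symm.trans hl'
        exact_mod_cast this
      simp [hPl, hPl', this]
    · exact (Set.Ici_infinite N).image (Nat.cast_injective.injOn)
  subst hPP
  have hne : (d.factorial : ℚ) ≠ 0 := by exact_mod_cast d.factorial_ne_zero
  have := he.symm.trans he'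
  field_simp at this
  exact_mod_cast this

/-- The multiplicity of a Noetherian local ring `R`: the unique number `e` such that the leading
coefficient of the Hilbert-Samuel polynomial of `R` is `e / d!`, where `d = dim R`. -/
noncomputable def mult (R : Type*) [CommRing R] [IsLocalRing R] : ℕ :=
  sInf {e : ℕ | HasMultiplicity R e}

/-- A binary numerical function: a map `f : ℕ∞ × ℕ∞ → ℕ∞`, non-decreasing in each of its arguments,
that takes the value `∞` exactly when one of its arguments is `∞`. -/
structure IsNumerical (f : ℕ∞ → ℕ∞ → ℕ∞) : Prop where
  mono : ∀ a a' b b' : ℕ∞, a ≤ a' → b ≤ b' → f a b ≤ f a' b'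
  eq_top_iff : ∀ a b : ℕ∞, f a b = ⊤ ↔ a = ⊤ ∨ b = ⊤

/-- For all `d`-tuples `x`, `y` with `d = n + 1` and `x` a system of parameters of `R`,
`ord_R (x₁y₁ + ⋯ + x_d y_d) ≤ f (ℓ(R/(x₁, …, x_d)), ord_{R/(x₁, …, x_{d-1})} y_d)`. -/
def OrderBound (R : Type*) [CommRing R] [IsLocalRing R] (n : ℕ) (f : ℕ∞ → ℕ∞ → ℕ∞) : Prop :=
  ∀ x y : Fin (n + 1) → R, IsSystemOfParameters x →
    ord (∑ i, x i * y i) ≤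
      f (Module.length R (R ⧸ Ideal.span (Set.range x)))
        (ordMod (Ideal.span (Set.range fun i : Fin n => x i.castSucc)) (y (Fin.last n)))

end UniformCM

/-!
# A uniform order bound characterizing Cohen-Macaulay local rings

The function `(a + 1) * (b + 2)` serves for every dimension and every multiplicity: the colength
`a` of the parameter ideal already controls everything that is needed.

Let `R` be Cohen-Macaulay, `x` a system of parameters with `ℓ(R/(x)) = a`, and
`I = (x₁, …, x_{d-1})`. Then `𝔪 ^ a ⊆ (x)`, so an element `∑ xᵢ yᵢ` of order at least
`a * (b + 2)` lies in `(x) ^ (b + 2) ⊆ I + (x_d ^ (b + 2))`. As `x_d` is a non-zero-divisor modulo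
`I`, it can be cancelled, and `y_d ∈ I + 𝔪 ^ (b + 1)`; so the order of `y_d` modulo `I` exceeds `b`
(`IsCohenMacaulay.orderBound`).

This uses that every system of parameters of a Cohen-Macaulay ring is a regular sequence, while the
definition provides just one regular sequence of length `d`. Two facts on depth bridge the gap: the
depth drops by one modulo any regular element (`DepthGE.sup_span_singleton`), and it is at most
`dim R/P` for each associated prime `P` (`DepthGE.coe_le_coheight`). If `x_k` were a zero divisor
modulo the earlier parameters, an associated prime would contain `x₁, …, x_k`, and its residue ring
would have dimension at most `d - k`, which is less than the depth `d - k + 1`.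

Conversely, assume the bound for some numerical function. A relation `∑ xᵢ yᵢ = 0` has infinite
order and `ℓ(R/(x))` is finite, so `y_d` has infinite order modulo `(x₁, …, x_{d-1})` and thus lies
in it. Hence the last member of each system of parameters is regular modulo the others. Replacing
the parameters other than `x₁, …, x_i` by high powers and letting the exponents grow shows that
`x_i` is regular modulo `(x₁, …, x_{i-1})` (`OrderBound.isRegularMod`), so `x` is a regular
sequence.
-/

namespace UniformCM

open IsLocalRing

/-! ### Orders, lengths and Krull's intersection theorem -/

theorem coe_le_adicOrder_iff {A : Type*} [CommRing A] (J : Ideal A) (a : A) (n : ℕ) :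
    (n : ℕ∞) ≤ adicOrder J a ↔ a ∈ J ^ n := by
  refine ⟨fun h => ?_, fun h => le_iSup₂_of_le n h le_rfl⟩
  cases n with
  | zero => simp
  | succ n =>
    have h' : (n : ℕ∞) < adicOrder J a := lt_of_lt_of_le (by exact_mod_cast n.lt_succ_self) h
    simp only [adicOrder, lt_iSup_iff] at h'
    obtain ⟨k, hk, hnk⟩ := h'
    exact Ideal.pow_le_pow_right (by exact_mod_cast hnk) hk

theorem adicOrder_zero {A : Type*} [CommRing A] (J : Ideal A) : adicOrder J 0 = ⊤ :=
  ENat.eq_top_iff_forall_ge.2 fun n => (coe_le_adicOrder_iff J 0 n).2 (zero_mem _)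

variable {R : Type*} [CommRing R]

theorem coe_le_ordMod_iff [IsLocalRing R] (I : Ideal R) (a : R) (n : ℕ) :
    (n : ℕ∞) ≤ ordMod I a ↔ a ∈ I ⊔ maximalIdeal R ^ n := by
  rw [ordMod, coe_le_adicOrder_iff, ← Ideal.map_pow, Ideal.mem_quotient_iff_mem_sup, sup_comm]

theorem mem_of_forall_mem_sup_pow [IsLocalRing R] [IsNoetherianRing R] {I : Ideal R} {a : R}
    (h : ∀ n, a ∈ I ⊔ maximalIdeal R ^ n) : a ∈ I := by
  have hb := Ideal.iInf_pow_smul_eq_bot_of_isLocalRing (M := R ⧸ I) (maximalIdeal R)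
    Ideal.IsPrime.ne_top'
  rw [← Ideal.Quotient.eq_zero_iff_mem, ← Submodule.mem_bot R, ← hb, Submodule.mem_iInf]
  intro n
  obtain ⟨i, hi, s, hs, rfl⟩ := Submodule.mem_sup.1 (h n)
  rw [map_add, Ideal.Quotient.eq_zero_iff_mem.2 hi, zero_add]
  have : (Ideal.Quotient.mk I) s = s • (1 : R ⧸ I) := by
    rw [Algebra.smul_def, mul_one]; rfl
  rw [this]
  exact Submodule.smul_mem_smul hs trivial

/-- The chain `I + 𝔪 ^ j` is strictly decreasing until `𝔪 ^ j` drops into `I`, by Nakayama. -/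
theorem coe_le_coheight_sup_pow [IsLocalRing R] [IsNoetherianRing R] (I : Ideal R) (j : ℕ)
    (h : ∀ i < j, ¬ maximalIdeal R ^ i ≤ I) :
    (j : ℕ∞) ≤ Order.coheight (I ⊔ maximalIdeal R ^ j) := by
  induction j with
  | zero => simp
  | succ j ih =>
    have hlt : I ⊔ maximalIdeal R ^ (j + 1) < I ⊔ maximalIdeal R ^ j := by
      refine lt_of_le_not_ge (sup_le_sup_left (Ideal.pow_le_pow_right j.le_succ) I) fun hle => ?_
      refine h j j.lt_succ_self ?_
      refine Submodule.le_of_le_smul_of_le_jacobson_bot (I := maximalIdeal R)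
        (IsNoetherian.noetherian _) (maximalIdeal_le_jacobson _) ?_
      rw [smul_eq_mul, ← pow_succ']
      exact le_sup_right.trans hle
    calc ((j + 1 : ℕ) : ℕ∞) = j + 1 := by push_cast; rfl
      _ ≤ Order.coheight (I ⊔ maximalIdeal R ^ j) + 1 := by
        gcongr; exact ih fun i hi => h i (hi.trans j.lt_succ_self)
      _ ≤ _ := Order.coheight_add_one_le hlt

theorem maximalIdeal_pow_le_of_length_eq [IsLocalRing R] [IsNoetherianRing R] {I : Ideal R} {a : ℕ}
    (h : Module.length R (R ⧸ I) = a) : maximalIdeal R ^ a ≤ I := by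
  by_contra hn
  have h1 := coe_le_coheight_sup_pow I (a + 1) fun i hi hle =>
    hn ((Ideal.pow_le_pow_right (Nat.lt_succ_iff.1 hi)).trans hle)
  have h2 : Order.coheight (I ⊔ maximalIdeal R ^ (a + 1)) ≤ a := by
    rw [← h, Module.length_quotient]
    exact Order.coheight_anti le_sup_left
  have := h1.trans h2
  norm_cast at this
  omega

theorem sup_pow_le_sup_pow (I J : Ideal R) (k : ℕ) : (I ⊔ J) ^ k ≤ I ⊔ J ^ k := by
  induction k with
  | zero => simp
  | succ k ih =>
    calc (I ⊔ J) ^ (k + 1) = (I ⊔ J) ^ k * (I ⊔ J) := pow_succ _ _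
      _ ≤ (I ⊔ J ^ k) * (I ⊔ J) := Ideal.mul_mono_left ih
      _ = I * (I ⊔ J) ⊔ (J ^ k * I ⊔ J ^ k * J) := by rw [Ideal.sup_mul, Ideal.mul_sup (J ^ k)]
      _ ≤ I ⊔ J ^ (k + 1) := by
        rw [pow_succ]
        exact sup_le (le_sup_of_le_left Ideal.mul_le_left) (sup_le_sup_right Ideal.mul_le_right _)

/-! ### Regular elements modulo an ideal and depth -/

/-- `r` is a non-zero-divisor on `R ⧸ I`; the condition `I ≠ ⊤` is not included. -/
def IsRegularMod (I : Ideal R) (r : R) : Prop := ∀ a, r * a ∈ I → a ∈ I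

/-- `R ⧸ I` is nonzero and admits a regular sequence of length `n` inside the maximal ideal.
Everything is expressed by ideals of the fixed ring `R`, so that no iterated quotients occur. -/
def DepthGE [IsLocalRing R] : ℕ → Ideal R → Prop
  | 0, I => I ≠ ⊤
  | n + 1, I => ∃ r ∈ maximalIdeal R, IsRegularMod I r ∧ DepthGE n (I ⊔ Ideal.span {r})

theorem DepthGE.ne_top [IsLocalRing R] {n : ℕ} {I : Ideal R} (h : DepthGE n I) : I ≠ ⊤ := by
  induction n generalizing I with
  | zero => exact h
  | succ n ih =>
    obtain ⟨r, -, -, hr⟩ := h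
    exact fun hI => ih hr (by simp [hI])

theorem mem_sup_span_singleton_iff {I : Ideal R} {r a : R} :
    a ∈ I ⊔ Ideal.span {r} ↔ ∃ i ∈ I, ∃ c, a = i + r * c := by
  rw [Submodule.mem_sup]
  constructor
  · rintro ⟨i, hi, z, hz, rfl⟩
    obtain ⟨c, rfl⟩ := Ideal.mem_span_singleton.1 hz
    exact ⟨i, hi, c, rfl⟩
  · rintro ⟨i, hi, c, rfl⟩
    exact ⟨i, hi, r * c, Ideal.mem_span_singleton.2 ⟨c, rfl⟩, rfl⟩

theorem IsRegularMod.swap {I : Ideal R} {x t : R} (hx : IsRegularMod I x)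
    (ht : IsRegularMod (I ⊔ Ideal.span {x}) t) : IsRegularMod (I ⊔ Ideal.span {t}) x := by
  intro a ha
  obtain ⟨i, hi, c, hc⟩ := mem_sup_span_singleton_iff.1 ha
  have h1 : t * c ∈ I ⊔ Ideal.span {x} :=
    mem_sup_span_singleton_iff.2 ⟨-i, neg_mem hi, a, by linear_combination -hc⟩
  obtain ⟨i', hi', c', rfl⟩ := mem_sup_span_singleton_iff.1 (ht c h1)
  have h2 : a - t * c' ∈ I := hx _ (by
    have : x * (a - t * c') = i + t * i' := by linear_combination hc
    rw [this]
    exact add_mem hi (I.mul_mem_left t hi'))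
  exact mem_sup_span_singleton_iff.2 ⟨_, h2, c', by ring⟩

/-- For `k` the residue field, the condition `Hom(k, R ⧸ J) = 0` passes from `J = I + (r)` to
`J = I + (x)` when `r` and `x` are regular modulo `I`: in both cases it expresses the vanishing of
`Ext¹(k, R ⧸ I)`. -/
theorem socle_eq_bot_of_regular [IsLocalRing R] {I : Ideal R} {r x : R} (hrm : r ∈ maximalIdeal R)
    (hr : IsRegularMod I r) (hx : IsRegularMod I x)
    (h : ∀ y, (∀ s ∈ maximalIdeal R, s * y ∈ I ⊔ Ideal.span {r}) → y ∈ I ⊔ Ideal.span {r})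
    {y : R} (hy : ∀ s ∈ maximalIdeal R, s * y ∈ I ⊔ Ideal.span {x}) :
    y ∈ I ⊔ Ideal.span {x} := by
  obtain ⟨i, hi, z, hz⟩ := mem_sup_span_singleton_iff.1 (hy r hrm)
  have hzr : z ∈ I ⊔ Ideal.span {r} := by
    refine h z fun s hs => ?_
    obtain ⟨j, hj, w, hw⟩ := mem_sup_span_singleton_iff.1 (hy s hs)
    have h1 : s * z - r * w ∈ I := hx _ (by
      have : x * (s * z - r * w) = r * j - s * i := by linear_combination r * hw - s * hz
      rw [this]
      exact sub_mem (I.mul_mem_left _ hj) (I.mul_mem_left _ hi))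
    exact mem_sup_span_singleton_iff.2 ⟨_, h1, w, by ring⟩
  obtain ⟨j, hj, v, rfl⟩ := mem_sup_span_singleton_iff.1 hzr
  have h2 : y - x * v ∈ I := hr _ (by
    have : r * (y - x * v) = i + x * j := by linear_combination hz
    rw [this]
    exact add_mem hi (I.mul_mem_left _ hj))
  exact mem_sup_span_singleton_iff.2 ⟨_, h2, v, by ring⟩

theorem mem_associatedPrimes_quotient_iff [IsNoetherianRing R] {I P : Ideal R} :
    P ∈ associatedPrimes R (R ⧸ I) ↔ P.IsPrime ∧ ∃ b, ∀ r, r ∈ P ↔ r * b ∈ I := by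
  rw [AssociatedPrimes.mem_iff, isAssociatedPrime_iff]
  have key : ∀ b r : R, r ∈ Submodule.colon (⊥ : Submodule R (R ⧸ I)) {Ideal.Quotient.mk I b} ↔
      r * b ∈ I := fun b r => by
    rw [Submodule.mem_colon_singleton, Submodule.mem_bot, ← Ideal.Quotient.eq_zero_iff_mem,
      map_mul, Algebra.smul_def]
    rfl
  refine and_congr_right fun _ => ⟨?_, ?_⟩
  · rintro ⟨x, rfl⟩
    obtain ⟨b, rfl⟩ := Ideal.Quotient.mk_surjective x
    exact ⟨b, key b⟩
  · rintro ⟨b, hb⟩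
    exact ⟨Ideal.Quotient.mk I b, Ideal.ext fun r => (hb r).trans (key b r).symm⟩

theorem exists_associatedPrime_of_notMem [IsNoetherianRing R] {I : Ideal R} {a : R} (ha : a ∉ I) :
    ∃ P ∈ associatedPrimes R (R ⧸ I), ∀ r, r * a ∈ I → r ∈ P := by
  obtain ⟨P, hP, hle⟩ := exists_le_isAssociatedPrime_of_isNoetherianRing R (Ideal.Quotient.mk I a)
    (fun h => ha (Ideal.Quotient.eq_zero_iff_mem.1 h))
  refine ⟨P, hP, fun r hr => hle ?_⟩
  rw [Submodule.mem_colon_singleton, Submodule.mem_bot]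
  exact Ideal.Quotient.eq_zero_iff_mem.2 hr

/-- Prime avoidance, for the associated primes of `R ⧸ I` and `R ⧸ J`. -/
theorem exists_isRegularMod_and [IsLocalRing R] [IsNoetherianRing R] {I J : Ideal R}
    (hI : ∀ y, (∀ s ∈ maximalIdeal R, s * y ∈ I) → y ∈ I)
    (hJ : ∀ y, (∀ s ∈ maximalIdeal R, s * y ∈ J) → y ∈ J) :
    ∃ t ∈ maximalIdeal R, IsRegularMod I t ∧ IsRegularMod J t := by
  have notAssoc : ∀ {K : Ideal R}, (∀ y, (∀ s ∈ maximalIdeal R, s * y ∈ K) → y ∈ K) →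
      ∀ P ∈ associatedPrimes R (R ⧸ K), ¬ maximalIdeal R ≤ P := by
    intro K hK P hP hle
    obtain ⟨hPp, b, hb⟩ := mem_associatedPrimes_quotient_iff.1 hP
    have hbK : b ∈ K := hK b fun s hs => (hb s).1 (hle hs)
    exact hPp.ne_top ((Ideal.eq_top_iff_one _).2 ((hb 1).2 (by simpa using hbK)))
  have fin := (associatedPrimes.finite R (R ⧸ I)).union (associatedPrimes.finite R (R ⧸ J))
  by_contra! hcon
  have hsub : (maximalIdeal R : Set R) ⊆
      ⋃ P ∈ associatedPrimes R (R ⧸ I) ∪ associatedPrimes R (R ⧸ J), (P : Set R) := by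
    intro t ht
    simp only [Set.mem_iUnion, exists_prop]
    by_cases h : IsRegularMod I t
    · have h' := hcon t ht h
      simp only [IsRegularMod, not_forall] at h'
      obtain ⟨a, hta, ha⟩ := h'
      obtain ⟨P, hP, hle⟩ := exists_associatedPrime_of_notMem ha
      exact ⟨P, Or.inr hP, hle t hta⟩
    · simp only [IsRegularMod, not_forall] at h
      obtain ⟨a, hta, ha⟩ := h
      obtain ⟨P, hP, hle⟩ := exists_associatedPrime_of_notMem ha
      exact ⟨P, Or.inl hP, hle t hta⟩
  obtain ⟨P, hP, hle⟩ := (Ideal.subset_union_prime_finite fin (f := id) 0 0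
    fun P hP _ _ => hP.elim (·.isPrime) (·.isPrime)).1 hsub
  exact hP.elim (fun h => notAssoc hI P h hle) (fun h => notAssoc hJ P h hle)

/-- Dividing out one regular element lowers the depth by exactly one, whichever element is
chosen. -/
theorem DepthGE.sup_span_singleton [IsLocalRing R] [IsNoetherianRing R] {n : ℕ} {I : Ideal R}
    (h : DepthGE (n + 1) I) {x : R} (hxm : x ∈ maximalIdeal R) (hx : IsRegularMod I x) :
    DepthGE n (I ⊔ Ideal.span {x}) := by
  induction n generalizing I x with
  | zero =>
    refine ne_top_of_le_ne_top (Ideal.IsPrime.ne_top' : maximalIdeal R ≠ ⊤)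
      (sup_le (le_maximalIdeal h.ne_top) ?_)
    rwa [Ideal.span_singleton_le_iff_mem]
  | succ n ih =>
    obtain ⟨r, hrm, hr, hd⟩ := h
    obtain ⟨r', hrm', hr', -⟩ := id hd
    have hsoc : ∀ y, (∀ s ∈ maximalIdeal R, s * y ∈ I ⊔ Ideal.span {r}) →
        y ∈ I ⊔ Ideal.span {r} := fun y hy => hr' y (hy r' hrm')
    obtain ⟨t, htm, htr, htx⟩ := exists_isRegularMod_and hsoc
      (fun y hy => socle_eq_bot_of_regular hrm hr hx hsoc hy)
    have h1 : DepthGE (n + 1) (I ⊔ Ideal.span {t}) :=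
      ⟨r, hrm, hr.swap htr, by rw [sup_right_comm]; exact ih hd htm htr⟩
    have h2 := ih h1 hxm (hx.swap htx)
    exact ⟨t, htm, htx, by rwa [sup_right_comm]⟩

/-- If `r` is regular modulo `I`, then each associated prime of `R ⧸ I` omits `r` and is contained
in an associated prime of `R ⧸ (I + (r))`. By Nakayama, the ideal `(I : P)` is not inside
`I + (r)`, and any element outside leads to such a prime. -/
theorem exists_associatedPrime_sup_span_singleton [IsLocalRing R] [IsNoetherianRing R] {I P : Ideal R}
    (hP : P ∈ associatedPrimes R (R ⧸ I)) {r : R} (hrm : r ∈ maximalIdeal R)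
    (hr : IsRegularMod I r) :
    ∃ Q ∈ associatedPrimes R (R ⧸ (I ⊔ Ideal.span {r})), P ≤ Q ∧ r ∈ Q ∧ r ∉ P := by
  obtain ⟨hPp, b, hb⟩ := mem_associatedPrimes_quotient_iff.1 hP
  have hbI : b ∉ I := fun h =>
    hPp.ne_top ((Ideal.eq_top_iff_one _).2 ((hb 1).2 (by simpa using h)))
  let N : Ideal R :=
    { carrier := {a | ∀ p ∈ P, p * a ∈ I}
      add_mem' := fun {a c} ha hc p hp => by rw [mul_add]; exact add_mem (ha p hp) (hc p hp)
      zero_mem' := fun p _ => by simp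
      smul_mem' := fun c a ha p hp => by
        rw [smul_eq_mul, mul_left_comm]; exact I.mul_mem_left _ (ha p hp) }
  have hbN : b ∈ N := fun p hp => (hb p).1 hp
  obtain ⟨c, hcN, hc⟩ : ∃ c ∈ N, c ∉ I ⊔ Ideal.span {r} := by
    by_contra! hcon
    suffices hNI : N ≤ I from hbI (hNI hbN)
    -- an element of `N ∩ (I + (r))` is congruent modulo `I` to a multiple `r * a` with `a ∈ N`
    refine Submodule.le_of_le_smul_of_le_jacobson_bot (I := Ideal.span {r})
      (IsNoetherian.noetherian N) ?_ fun c hc => ?_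
    · exact (Ideal.span_singleton_le_iff_mem _ |>.2 hrm).trans (maximalIdeal_le_jacobson _)
    obtain ⟨i, hi, a, rfl⟩ := mem_sup_span_singleton_iff.1 (hcon c hc)
    refine Submodule.add_mem_sup hi (Submodule.smul_mem_smul (Ideal.mem_span_singleton_self r) ?_)
    intro p hp
    refine hr _ ?_
    have : r * (p * a) = p * (i + r * a) - p * i := by ring
    rw [this]
    exact sub_mem (hc p hp) (I.mul_mem_left p hi)
  obtain ⟨Q, hQ, hle⟩ := exists_associatedPrime_of_notMem hc
  refine ⟨Q, hQ, fun p hp => hle p (Ideal.mem_sup_left (hcN p hp)), hle r ?_, fun hrP => ?_⟩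
  · exact Ideal.mem_sup_right (Ideal.mem_span_singleton.2 ⟨c, rfl⟩)
  · exact hbI (hr b ((hb r).1 hrP))

/-- Unmixedness: the depth bounds the dimension of `R ⧸ P` from below for every associated
prime `P`. -/
theorem DepthGE.coe_le_coheight [IsLocalRing R] [IsNoetherianRing R] {n : ℕ} {I : Ideal R} (h : DepthGE n I)
    {P : Ideal R} (hP : P ∈ associatedPrimes R (R ⧸ I)) :
    (n : ℕ∞) ≤ Order.coheight (⟨P, hP.isPrime⟩ : PrimeSpectrum R) := by
  induction n generalizing I P with
  | zero => simp
  | succ n ih =>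
    obtain ⟨r, hrm, hr, hd⟩ := h
    obtain ⟨Q, hQ, hPQ, hrQ, hrP⟩ := exists_associatedPrime_sup_span_singleton hP hrm hr
    calc ((n + 1 : ℕ) : ℕ∞) = n + 1 := by push_cast; rfl
      _ ≤ Order.coheight (⟨Q, hQ.isPrime⟩ : PrimeSpectrum R) + 1 := by gcongr; exact ih hd hQ
      _ ≤ _ := Order.coheight_add_one_le (lt_of_le_of_ne hPQ fun h => hrP (by
        have : P = Q := congrArg PrimeSpectrum.asIdeal h
        rwa [this]))

/-! ### Systems of parameters in Cohen-Macaulay rings -/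

theorem depthGE_of_isWeaklyRegular [IsLocalRing R] (l₁ l₂ : List R)
    (hm : ∀ r ∈ l₁ ++ l₂, r ∈ maximalIdeal R)
    (h : RingTheory.Sequence.IsWeaklyRegular R (l₁ ++ l₂)) :
    DepthGE l₂.length (Ideal.ofList l₁) := by
  induction l₂ generalizing l₁ with
  | nil =>
    refine ne_top_of_le_ne_top (Ideal.IsPrime.ne_top' : maximalIdeal R ≠ ⊤) ?_
    exact Ideal.span_le.2 fun r hr => hm r (by simpa using hr)
  | cons r l ih =>
    have e : l₁ ++ r :: l = (l₁ ++ [r]) ++ l := by simp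
    refine ⟨r, hm r (by simp), fun a ha => ?_, ?_⟩
    · have h1 := h.regular_mod_prev l₁.length (by simp)
      rw [isSMulRegular_quotient_iff_mem_of_smul_mem] at h1
      simpa using h1 a (by simpa using ha)
    · have h1 := ih (l₁ ++ [r]) (by rwa [← e]) (by rwa [← e])
      rwa [Ideal.ofList_append, Ideal.ofList_singleton] at h1

theorem IsCohenMacaulay.depthGE [IsLocalRing R] {n : ℕ} (h : IsCohenMacaulay R)
    (hd : ringKrullDim R = ((n + 1 : ℕ) : WithBot ℕ∞)) : DepthGE (n + 1) (⊥ : Ideal R) := by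
  have h1 : depth R = ((n + 1 : ℕ) : ℕ∞) := by
    have := h.symm.trans hd
    exact_mod_cast this
  have h2 : (n : ℕ∞) < depth R := by rw [h1]; exact_mod_cast n.lt_succ_self
  simp only [depth, lt_iSup_iff] at h2
  obtain ⟨rs, ⟨hm, hreg⟩, hlt⟩ := h2
  have hlen : n + 1 ≤ rs.length := by exact_mod_cast hlt
  have e : rs.take (n + 1) ++ rs.drop (n + 1) = rs := rs.take_append_drop (n + 1)
  have hw : RingTheory.Sequence.IsWeaklyRegular R (rs.take (n + 1)) := by
    have := hreg.toIsWeaklyRegular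
    rw [← e, RingTheory.Sequence.isWeaklyRegular_append_iff] at this
    exact this.1
  have := depthGE_of_isWeaklyRegular [] (rs.take (n + 1))
    (fun r hr => hm r (List.mem_of_mem_take (by simpa using hr))) hw
  rwa [List.length_take, min_eq_left hlen, Ideal.ofList_nil] at this

/-- The ideal generated by the first `k` members of the tuple `x`. -/
def prefixIdeal {d : ℕ} (x : Fin d → R) (k : ℕ) : Ideal R :=
  Ideal.span (x '' {j | (j : ℕ) < k})

theorem prefixIdeal_zero {d : ℕ} (x : Fin d → R) : prefixIdeal x 0 = ⊥ := by
  simp [prefixIdeal]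

theorem prefixIdeal_succ {d : ℕ} (x : Fin d → R) (k : Fin d) :
    prefixIdeal x (k + 1) = prefixIdeal x k ⊔ Ideal.span {x k} := by
  have : {j : Fin d | (j : ℕ) < k + 1} = {j : Fin d | (j : ℕ) < k} ∪ {k} := by
    ext j
    simp only [Set.mem_ofPred_eq, Set.mem_union, Set.mem_singleton_iff, Fin.ext_iff]
    omega
  rw [prefixIdeal, this, Set.image_union, Set.image_singleton, Ideal.span_union, prefixIdeal]

theorem prefixIdeal_last {n : ℕ} (x : Fin (n + 1) → R) :
    prefixIdeal x n = Ideal.span (Set.range fun i : Fin n => x i.castSucc) := by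
  rw [prefixIdeal]
  congr 1
  ext a
  constructor
  · rintro ⟨j, hj, rfl⟩
    exact ⟨⟨j, hj⟩, rfl⟩
  · rintro ⟨j, rfl⟩
    exact ⟨j.castSucc, j.2, rfl⟩

theorem span_range_eq_sup_last {n : ℕ} (x : Fin (n + 1) → R) :
    Ideal.span (Set.range x) =
      Ideal.span (Set.range fun i : Fin n => x i.castSucc) ⊔ Ideal.span {x (Fin.last n)} := by
  have h := prefixIdeal_succ x (Fin.last n)
  rw [Fin.val_last, prefixIdeal_last] at h
  rw [← h, prefixIdeal]
  congr 1
  rw [← Set.image_univ]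
  congr 1
  ext j
  simpa using j.is_le

theorem IsSystemOfParameters.mem [IsLocalRing R] {d : ℕ} {x : Fin d → R}
    (hx : IsSystemOfParameters x) (i : Fin d) : x i ∈ maximalIdeal R :=
  hx.2 ▸ Ideal.le_radical (Ideal.subset_span ⟨i, rfl⟩)

/-- A prime containing the first `k` of `d` parameters has a residue ring of dimension at most
`d - k`, since the maximal ideal of that ring is minimal over the images of the remaining ones. -/
theorem IsSystemOfParameters.coheight_le [IsLocalRing R] [IsNoetherianRing R] {d k m : ℕ}
    {x : Fin d → R} (hx : IsSystemOfParameters x) (hkm : k + m = d) (P : PrimeSpectrum R)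
    (hP : prefixIdeal x k ≤ P.asIdeal) : Order.coheight P ≤ m := by
  have hdim : ringKrullDim (R ⧸ P.asIdeal) = Order.coheight P := by
    rw [ringKrullDim_quotient, Order.coheight_eq_krullDim_Ici]
    rfl
  have : IsLocalRing (R ⧸ P.asIdeal) :=
    IsLocalRing.of_surjective' (Ideal.Quotient.mk P.asIdeal) Ideal.Quotient.mk_surjective
  let s : Finset (R ⧸ P.asIdeal) := by
    classical
    exact (Finset.univ.filter fun j : Fin d => k ≤ (j : ℕ)).image
      fun j => Ideal.Quotient.mk P.asIdeal (x j)
  have hcard : s.card ≤ m := by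
    classical
    refine Finset.card_image_le.trans ?_
    rw [← Finset.card_map Fin.valEmbedding]
    have : (Finset.univ.filter fun j : Fin d => k ≤ (j : ℕ)).map Fin.valEmbedding
        ⊆ Finset.Ico k d := by
      intro j hj
      simp only [Finset.mem_map, Finset.mem_filter, Finset.mem_univ, true_and,
        Fin.valEmbedding_apply] at hj
      obtain ⟨i, hi, rfl⟩ := hj
      exact Finset.mem_Ico.2 ⟨hi, i.2⟩
    refine (Finset.card_le_card this).trans ?_
    rw [Nat.card_Ico]
    omega
  have hle : ∀ Q : Ideal (R ⧸ P.asIdeal), Q.IsPrime → Ideal.span (s : Set (R ⧸ P.asIdeal)) ≤ Q →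
      maximalIdeal (R ⧸ P.asIdeal) ≤ Q := by
    intro Q hQ hsQ z hz
    obtain ⟨r, rfl⟩ := Ideal.Quotient.mk_surjective z
    have hr : r ∈ maximalIdeal R := by
      rw [mem_maximalIdeal, mem_nonunits_iff] at hz ⊢
      exact fun hu => hz (hu.map _)
    have hrad : maximalIdeal R ≤ Q.comap (Ideal.Quotient.mk P.asIdeal) := by
      rw [← hx.2, (hQ.comap _).radical_le_iff, Ideal.span_le]
      rintro _ ⟨j, rfl⟩
      rw [SetLike.mem_coe, Ideal.mem_comap]
      by_cases hj : (j : ℕ) < k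
      · rw [Ideal.Quotient.eq_zero_iff_mem.2 (hP (Ideal.subset_span ⟨j, hj, rfl⟩))]
        exact zero_mem _
      · refine hsQ (Ideal.subset_span ?_)
        simp only [s, Finset.coe_image, Set.mem_image, Finset.mem_coe, Finset.mem_filter,
          Finset.mem_univ, true_and]
        exact ⟨j, not_lt.1 hj, rfl⟩
    exact hrad hr
  have hsm : (s : Set (R ⧸ P.asIdeal)) ⊆ maximalIdeal (R ⧸ P.asIdeal) := by
    intro z hz
    simp only [s, Finset.coe_image, Set.mem_image] at hz
    obtain ⟨j, -, rfl⟩ := hz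
    rw [SetLike.mem_coe, mem_maximalIdeal, mem_nonunits_iff]
    intro hu
    have hnt : ¬ IsUnit (x j) := hx.mem j
    have : IsLocalHom (Ideal.Quotient.mk P.asIdeal) :=
      .of_surjective _ Ideal.Quotient.mk_surjective
    exact hnt (isUnit_of_map_unit _ _ hu)
  have hmin : maximalIdeal (R ⧸ P.asIdeal) ∈
      (Ideal.span (s : Set (R ⧸ P.asIdeal))).minimalPrimes :=
    ⟨⟨inferInstance, Ideal.span_le.2 hsm⟩, fun Q hQ _ => hle Q hQ.1 hQ.2⟩
  have hht := Ideal.height_le_card_of_mem_minimalPrimes_span_finset hmin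
  have h1 : (Order.coheight P : WithBot ℕ∞) = (maximalIdeal (R ⧸ P.asIdeal)).height := by
    rw [← hdim, maximalIdeal_height_eq_ringKrullDim]
  have h2 : Order.coheight P = (maximalIdeal (R ⧸ P.asIdeal)).height := by exact_mod_cast h1
  rw [h2]
  exact hht.trans (by exact_mod_cast hcard)

theorem IsSystemOfParameters.isRegularMod [IsLocalRing R] [IsNoetherianRing R] {d m : ℕ}
    {x : Fin d → R} (hx : IsSystemOfParameters x) (k : Fin d) (hkm : k + (m + 1) = d)
    (h : DepthGE (m + 1) (prefixIdeal x k)) : IsRegularMod (prefixIdeal x k) (x k) := by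
  intro a ha
  by_contra hna
  obtain ⟨P, hP, hle⟩ := exists_associatedPrime_of_notMem hna
  have hxP : prefixIdeal x (k + 1) ≤ P := by
    rw [prefixIdeal_succ]
    refine sup_le (fun r hr => hle r (Ideal.mul_mem_right _ _ hr)) ?_
    exact (Ideal.span_singleton_le_iff_mem _).2 (hle _ ha)
  have h1 := h.coe_le_coheight hP
  have h2 := hx.coheight_le (m := m) (by omega) ⟨P, hP.isPrime⟩ hxP
  have h3 := h1.trans h2
  norm_cast at h3
  omega

theorem IsSystemOfParameters.depthGE [IsLocalRing R] [IsNoetherianRing R] {d : ℕ}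
    {x : Fin d → R} (hx : IsSystemOfParameters x) (h : DepthGE d (⊥ : Ideal R)) {k m : ℕ}
    (hkm : k + m = d) : DepthGE m (prefixIdeal x k) := by
  induction k generalizing m with
  | zero =>
    obtain rfl : m = d := by omega
    rwa [prefixIdeal_zero]
  | succ k ih =>
    have h1 : DepthGE (m + 1) (prefixIdeal x k) := ih (by omega)
    let i : Fin d := ⟨k, by omega⟩
    have h2 : IsRegularMod (prefixIdeal x k) (x i) := hx.isRegularMod i (by simp [i]; omega) h1
    have h3 := prefixIdeal_succ x i
    simp only [i] at h3
    rw [h3]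
    exact h1.sup_span_singleton (hx.mem i) h2

theorem IsCohenMacaulay.isRegularMod_last [IsLocalRing R] [IsNoetherianRing R] {n : ℕ}
    (h : IsCohenMacaulay R) {x : Fin (n + 1) → R} (hx : IsSystemOfParameters x) :
    IsRegularMod (Ideal.span (Set.range fun i : Fin n => x i.castSucc)) (x (Fin.last n)) := by
  have h1 := hx.isRegularMod (m := 0) (Fin.last n) (by simp)
    (hx.depthGE (h.depthGE hx.1) (by simp))
  rwa [Fin.val_last, prefixIdeal_last] at h1

/-! ### The uniform bound -/

/-- The bound `(a + 1) * (b + 2)`. The summand `1` keeps the first factor nonzero, so that the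
product is infinite as soon as one of the arguments is. -/
def orderBoundFun (a b : ℕ∞) : ℕ∞ := (a + 1) * (b + 2)

theorem isNumerical_orderBoundFun : IsNumerical orderBoundFun where
  mono a a' b b' ha hb := by unfold orderBoundFun; gcongr
  eq_top_iff a b := by
    rw [orderBoundFun]
    induction a with
    | top => simp [ENat.top_mul]
    | coe a =>
      induction b with
      | top => simp [ENat.mul_top]
      | coe b => exact iff_of_false (by exact_mod_cast ENat.natCast_ne_top _) (by simp)

theorem IsCohenMacaulay.orderBound [IsLocalRing R] [IsNoetherianRing R] (h : IsCohenMacaulay R)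
    (n : ℕ) : OrderBound R n orderBoundFun := by
  intro x y hx
  have hreg := h.isRegularMod_last hx
  set I := Ideal.span (Set.range fun i : Fin n => x i.castSucc) with hI
  set X := x (Fin.last n) with hX
  rcases eq_or_ne (Module.length R (R ⧸ Ideal.span (Set.range x))) ⊤ with ha | ha
  · rw [(isNumerical_orderBoundFun.eq_top_iff _ _).2 (Or.inl ha)]; exact le_top
  rcases eq_or_ne (ordMod I (y (Fin.last n))) ⊤ with hb | hb
  · rw [(isNumerical_orderBoundFun.eq_top_iff _ _).2 (Or.inr hb)]; exact le_top
  obtain ⟨a, ha⟩ := ENat.ne_top_iff_exists.1 ha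
  obtain ⟨b, hb⟩ := ENat.ne_top_iff_exists.1 hb
  rw [← ha, ← hb]
  have hma : maximalIdeal R ^ a ≤ Ideal.span (Set.range x) :=
    maximalIdeal_pow_le_of_length_eq ha.symm
  by_contra! hlt
  have hle : ((a * (b + 2) : ℕ) : ℕ∞) ≤ ord (∑ i, x i * y i) := by
    refine le_trans ?_ hlt.le
    rw [orderBoundFun]
    norm_cast
    gcongr
    omega
  rw [ord, coe_le_adicOrder_iff] at hle
  have hz : ∑ i, x i * y i ∈ I ⊔ Ideal.span {X ^ (b + 2)} := by
    have h1 : maximalIdeal R ^ (a * (b + 2)) ≤ I ⊔ Ideal.span {X ^ (b + 2)} := by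
      rw [pow_mul, ← Ideal.span_singleton_pow]
      refine (Ideal.pow_right_mono hma _).trans ?_
      rw [span_range_eq_sup_last]
      exact sup_pow_le_sup_pow _ _ _
    exact h1 hle
  obtain ⟨i, hi, c, hc⟩ := mem_sup_span_singleton_iff.1 hz
  rw [Fin.sum_univ_castSucc] at hc
  have hsum : ∑ j : Fin n, x j.castSucc * y j.castSucc ∈ I :=
    sum_mem fun j _ => I.mul_mem_right _ (Ideal.subset_span ⟨j, rfl⟩)
  have hy : y (Fin.last n) - X ^ (b + 1) * c ∈ I := hreg _ (by
    have : X * (y (Fin.last n) - X ^ (b + 1) * c) =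
        i - ∑ j : Fin n, x j.castSucc * y j.castSucc := by linear_combination hc
    rw [this]
    exact sub_mem hi hsum)
  have hmem : y (Fin.last n) ∈ I ⊔ maximalIdeal R ^ (b + 1) := by
    rw [← sub_add_cancel (y (Fin.last n)) (X ^ (b + 1) * c)]
    exact Submodule.add_mem_sup hy
      (Ideal.mul_mem_right _ _ (Ideal.pow_mem_pow (hx.mem (Fin.last n)) _))
  rw [← coe_le_ordMod_iff, ← hb] at hmem
  norm_cast at hmem
  omega

/-! ### From the bound to Cohen-Macaulayness -/

theorem length_quotient_ne_top [IsLocalRing R] [IsNoetherianRing R] {I : Ideal R}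
    (h : I.radical = maximalIdeal R) : Module.length R (R ⧸ I) ≠ ⊤ := by
  have hmin : maximalIdeal R ∈ I.minimalPrimes := by
    rw [← Ideal.radical_minimalPrimes, h, Ideal.minimalPrimes_eq_subsingleton_self]
    rfl
  have := quotient_artinian_of_mem_minimalPrimes_of_isLocalRing I hmin
  rw [Module.length_eq_of_surjective (R := R ⧸ I) (S := R) (M := R ⧸ I)
    Ideal.Quotient.mk_surjective]
  exact Module.length_ne_top

theorem exists_isSystemOfParameters [IsLocalRing R] [IsNoetherianRing R] {d : ℕ}
    (hd : ringKrullDim R = (d : WithBot ℕ∞)) : ∃ x : Fin d → R, IsSystemOfParameters x := by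
  obtain ⟨s, hs, hcard⟩ := (maximalIdeal R).exists_finset_card_eq_height_of_isNoetherianRing
  have hsd : s.card = d := by
    have h1 : ((maximalIdeal R).height : WithBot ℕ∞) = d :=
      maximalIdeal_height_eq_ringKrullDim.trans hd
    rw [← hcard] at h1
    exact_mod_cast h1
  let e := s.equivFinOfCardEq hsd
  refine ⟨fun i => e.symm i, hd, ?_⟩
  have hr : Set.range (fun i => (e.symm i : R)) = s := by
    ext a
    constructor
    · rintro ⟨i, rfl⟩
      exact (e.symm i).2
    · intro ha
      exact ⟨e ⟨a, ha⟩, by simp⟩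
  rw [hr]
  refine le_antisymm (Ideal.IsPrime.radical_le_iff inferInstance |>.2 hs.1.2) ?_
  rw [Ideal.radical_eq_sInf]
  exact le_sInf fun Q hQ => hs.2 ⟨hQ.2, hQ.1⟩ (le_maximalIdeal hQ.2.ne_top)

/-- A relation `∑ xᵢ yᵢ = 0` has infinite order, so the bound forces `y_d` to have infinite order
modulo the other parameters, that is, to lie in the ideal they generate. -/
theorem OrderBound.isRegularMod_last [IsLocalRing R] [IsNoetherianRing R] {n : ℕ}
    {f : ℕ∞ → ℕ∞ → ℕ∞} (hf : IsNumerical f) (h : OrderBound R n f) {x : Fin (n + 1) → R}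
    (hx : IsSystemOfParameters x) :
    IsRegularMod (Ideal.span (Set.range fun i : Fin n => x i.castSucc)) (x (Fin.last n)) := by
  intro a ha
  obtain ⟨c, hc⟩ := (Ideal.mem_span_range_iff_exists_fun).1 ha
  have h1 := h x (Fin.snoc (α := fun _ => R) (fun i => -c i) a) hx
  have h2 : ∑ i, x i * Fin.snoc (α := fun _ => R) (fun i => -c i) a i = 0 := by
    rw [Fin.sum_univ_castSucc]
    simp only [Fin.snoc_castSucc, Fin.snoc_last]
    rw [← hc, ← Finset.sum_add_distrib]
    exact Finset.sum_eq_zero fun i _ => by ring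
  rw [h2, ord, adicOrder_zero, Fin.snoc_last, top_le_iff, hf.eq_top_iff] at h1
  have h3 := h1.resolve_left (length_quotient_ne_top hx.2)
  exact mem_of_forall_mem_sup_pow fun n => (coe_le_ordMod_iff _ _ n).1 (h3 ▸ le_top)

/-- Move `xᵢ` to the last place and replace the parameters after it by high powers, which
disappear in the limit by Krull's intersection theorem. -/
theorem OrderBound.isRegularMod [IsLocalRing R] [IsNoetherianRing R] {n : ℕ}
    {f : ℕ∞ → ℕ∞ → ℕ∞} (hf : IsNumerical f) (h : OrderBound R n f) {x : Fin (n + 1) → R}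
    (hx : IsSystemOfParameters x) (i : Fin (n + 1)) : IsRegularMod (prefixIdeal x i) (x i) := by
  intro a ha
  refine mem_of_forall_mem_sup_pow fun t => ?_
  let w : Fin (n + 1) → R := fun j => if j ≤ i then x j else x j ^ (t + 1)
  let z : Fin (n + 1) → R := w ∘ Equiv.swap i (Fin.last n)
  have hwm : ∀ j, w j ∈ maximalIdeal R := fun j => by
    simp only [w]
    split_ifs
    · exact hx.mem j
    · exact Ideal.pow_mem_of_mem _ (hx.mem j) _ t.succ_pos
  have hz : IsSystemOfParameters z := by
    refine ⟨hx.1, ?_⟩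
    rw [(Equiv.swap i (Fin.last n)).surjective.range_comp]
    refine le_antisymm (Ideal.IsPrime.radical_le_iff inferInstance |>.2 ?_) ?_
    · rw [Ideal.span_le]
      rintro _ ⟨j, rfl⟩
      exact hwm j
    · rw [← hx.2, Ideal.radical_le_radical_iff, Ideal.span_le]
      rintro _ ⟨j, rfl⟩
      have hj : w j ∈ Ideal.span (Set.range w) := Ideal.subset_span ⟨j, rfl⟩
      simp only [w] at hj
      split_ifs at hj
      · exact Ideal.le_radical hj
      · exact ⟨t + 1, hj⟩
  have hlast : z (Fin.last n) = x i := by simp [z, w]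
  have hreg := h.isRegularMod_last hf hz
  rw [hlast] at hreg
  have hz_mem : ∀ j : Fin (n + 1), j ≠ i →
      w j ∈ Ideal.span (Set.range fun j : Fin n => z j.castSucc) := by
    intro j hj
    have hne : Equiv.swap i (Fin.last n) j ≠ Fin.last n := fun hc => hj (by
      simpa using congrArg (Equiv.swap i (Fin.last n)) hc)
    refine Ideal.subset_span ⟨(Equiv.swap i (Fin.last n) j).castPred hne, ?_⟩
    simp [z]
  have h1 : prefixIdeal x i ≤ Ideal.span (Set.range fun j : Fin n => z j.castSucc) := by
    rw [prefixIdeal, Ideal.span_le]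
    rintro _ ⟨j, hj, rfl⟩
    have hji : j < i := hj
    have := hz_mem j hji.ne
    simpa [w, hji.le] using this
  have h2 : Ideal.span (Set.range fun j : Fin n => z j.castSucc) ≤
      prefixIdeal x i ⊔ maximalIdeal R ^ t := by
    rw [Ideal.span_le]
    rintro _ ⟨j, rfl⟩
    have hne : Equiv.swap i (Fin.last n) j.castSucc ≠ i := fun hc => by
      have := congrArg (Equiv.swap i (Fin.last n)) hc
      rw [Equiv.swap_apply_self, Equiv.swap_apply_left] at this
      exact (Fin.castSucc_lt_last j).ne this
    simp only [z, w, Function.comp_apply, SetLike.mem_coe]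
    generalize Equiv.swap i (Fin.last n) j.castSucc = k at hne
    split_ifs with hki
    · exact Ideal.mem_sup_left (Ideal.subset_span ⟨k, lt_of_le_of_ne hki hne, rfl⟩)
    · exact Ideal.mem_sup_right
        (Ideal.pow_le_pow_right t.le_succ (Ideal.pow_mem_pow (hx.mem k) _))
  exact h2 (hreg a (h1 ha))

theorem ofList_take_ofFn {d : ℕ} (x : Fin d → R) (k : ℕ) :
    Ideal.ofList ((List.ofFn x).take k) = prefixIdeal x k := by
  rw [Ideal.ofList, prefixIdeal]
  congr 1
  ext a
  simp only [Set.mem_ofPred_eq, List.mem_take_iff_getElem, Set.mem_image, List.length_ofFn,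
    List.getElem_ofFn]
  constructor
  · rintro ⟨j, hj, rfl⟩
    exact ⟨⟨j, by omega⟩, by simp; omega, rfl⟩
  · rintro ⟨j, hj, rfl⟩
    exact ⟨j, by omega, rfl⟩

theorem depth_le_ringKrullDim [IsLocalRing R] [IsNoetherianRing R] :
    (depth R : WithBot ℕ∞) ≤ ringKrullDim R := by
  obtain ⟨D, hD⟩ : ∃ D : ℕ∞, ringKrullDim R = D := ⟨_, maximalIdeal_height_eq_ringKrullDim.symm⟩
  rw [hD, WithBot.coe_le_coe]
  refine iSup₂_le fun rs hrs => ?_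
  have h := ringKrullDim_add_length_eq_ringKrullDim_of_isRegular rs hrs.2
  have : Nontrivial (R ⧸ Ideal.ofList rs) := Ideal.Quotient.nontrivial_iff.2 fun htop =>
    hrs.2.top_ne_smul (by simp [htop])
  have h0 : 0 ≤ ringKrullDim (R ⧸ Ideal.ofList rs) := ringKrullDim_nonneg_of_nontrivial
  have h1 : ((rs.length : ℕ∞) : WithBot ℕ∞) ≤ D := by
    rw [← hD, ← h]
    exact le_add_of_nonneg_left h0
  exact_mod_cast h1

theorem OrderBound.isCohenMacaulay [IsLocalRing R] [IsNoetherianRing R] {n : ℕ}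
    {f : ℕ∞ → ℕ∞ → ℕ∞} (hf : IsNumerical f) (h : OrderBound R n f)
    (hd : ringKrullDim R = ((n + 1 : ℕ) : WithBot ℕ∞)) : IsCohenMacaulay R := by
  obtain ⟨x, hx⟩ := exists_isSystemOfParameters hd
  refine le_antisymm ?_ depth_le_ringKrullDim
  have hm : ∀ r ∈ List.ofFn x, r ∈ maximalIdeal R := by
    intro r hr
    obtain ⟨i, rfl⟩ := (List.mem_ofFn' _ _).1 hr
    exact hx.mem i
  have hreg : RingTheory.Sequence.IsRegular R (List.ofFn x) := by
    rw [isRegular_iff_isWeaklyRegular_of_subset_maximalIdeal hm]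
    refine ⟨fun i hi => ?_⟩
    rw [isSMulRegular_quotient_iff_mem_of_smul_mem, ofList_take_ofFn, List.getElem_ofFn]
    intro a ha
    have := h.isRegularMod hf hx ⟨i, by simpa using hi⟩ a (by simpa using ha)
    simpa using this
  have h1 : ((n + 1 : ℕ) : ℕ∞) ≤ depth R :=
    le_iSup₂_of_le (List.ofFn x) ⟨hm, hreg⟩ (by simp)
  rw [hd]
  exact_mod_cast h1

end UniformCM

theorem theorem12p12 :
    ∃ δ : ℕ → ℕ → ℕ∞ → ℕ∞ → ℕ∞, (∀ d e : ℕ, UniformCM.IsNumerical (δ d e)) ∧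
      ∀ (R : Type u) [CommRing R] [IsLocalRing R] [IsNoetherianRing R] (n : ℕ),
        ringKrullDim R = ((n + 1 : ℕ) : WithBot ℕ∞) →
          (UniformCM.IsCohenMacaulay R ↔
            ∃ f : ℕ∞ → ℕ∞ → ℕ∞, UniformCM.IsNumerical f ∧ UniformCM.OrderBound R n f) ∧
          (UniformCM.IsCohenMacaulay R ↔
            UniformCM.OrderBound R n (δ (n + 1) (UniformCM.mult R))) := by
  refine ⟨fun _ _ => UniformCM.orderBoundFun, fun _ _ => UniformCM.isNumerical_orderBoundFun,
    fun R _ _ _ n hd => ⟨⟨fun h => ?_, ?_⟩, fun h => h.orderBound n, fun h => ?_⟩⟩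
  · exact ⟨_, UniformCM.isNumerical_orderBoundFun, h.orderBound n⟩
  · rintro ⟨f, hf, h⟩
    exact h.isCohenMacaulay hf hd
  · exact h.isCohenMacaulay UniformCM.isNumerical_orderBoundFun hd
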